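/- Conventions. A real polynomial $p$ in $m$ variables, homogeneous of degree $n$, is called hyperbolic in direction $e\in\mathbb R^m$ if $p(e)\neq 0$ and for every $X\in\mathbb R^m$ the univariate polynomial $t\mapsto p(X-te)$ has exactly $n$ real roots counted with multiplicity. With $e=(1,\dots,1)$, $p$ is called POS-hyperbolic if $p(e)>0$, $p$ is hyperbolic in direction $e$, and for every $X\in\mathbb R^m$ with nonnegative coordinates all roots of $t\mapsto p(X-te)$ are nonnegative. $\mathrm{Rank}_p(X)$ is the number of nonzero roots of $t\mapsto p(X-te)$, counted with multiplicity, where $e=(1,\dots,1)$. For a polynomial $p$ in $m$ variables, $\mathrm{Cap}(p)=\inf\{p(x): x_1,\dots,x_m>0,\ \prod_i x_i=1\}$ (for $m=0$ this is the value of the constant $p$). For $p$ in $n\ge 1$ variables, $p_{x_i}$ is the polynomial $\partial p/\partial x_i$ evaluated at $x_i=0$, in the $n-1$ remaining variables. $S_p(\{i\})$ is the largest exponent of $x_i$ in a monomial of $p$ with nonzero coefficient ($0$ if $p=0$). Put $g(k)=\left(\frac{k-1}{k}\right)^{k-1}$ for integers $k\ge 1$, with $g(1)=0^0=1$, and $g(0)=1$.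 Let $\mathrm{Hom}_+(n,n)$ be the set of real polynomials in $n$ variables, homogeneous of degree $n$, with nonnegative coefficients (including $0$). A family $F=\bigcup_{n\ge1}F_n$ with $F_n\subseteq \mathrm{Hom}_+(n,n)$ is a VDW-family if (a) for $n>1$, $p\in F_n$ and $1\le i\le n$ one has $p_{x_i}\in F_{n-1}$, and (b) for $n\ge 1$, $p\in F_n$ and $1\le i\le n$ one has $\mathrm{Cap}(p_{x_i})\ge g(S_p(\{i\}))\,\mathrm{Cap}(p)$. Theorem. Let $n\ge 1$ and let $q$ be a POS-hyperbolic polynomial of degree $n$ in $n$ variables. 1. If $\mathrm{Rank}_q(e_1)=k\ge 1$, where $e_1=(1,0,\dots,0)$, then $\mathrm{Cap}(q_{x_1})\ge \left(\frac{k-1}{k}\right)^{k-1}\mathrm{Cap}(q)$. 2. Either $q_{x_1}=0$ or $q_{x_1}$ is POS-hyperbolic of degree $n-1$ in the $n-1$ variables $x_2,\dots,x_n$. If $\mathrm{Cap}(q)>0$, then $q_{x_1}$ is nonzero and POS-hyperbolic. Corollary. Let $PHP(n)$ be the set of POS-hyperbolic polynomials of degree $n$ in $n$ variables and $PHP_+(n)=\{p\in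 PHP(n):\mathrm{Cap}(p)>0\}$. Then $\bigcup_{n\ge 1}(PHP(n)\cup\{0\})$ and $\bigcup_{n\ge 1}PHP_+(n)$ are VDW-families; in particular, POS-hyperbolic polynomials of degree $n$ in $n$ variables have nonnegative coefficients. -/

import Mathlib

namespace VDW

/-- `Hom(m, n)` with nonnegative coefficients: real homogeneous polynomials of degree `n` in `m`
variables, all of whose coefficients are nonnegative. -/
def HomPlus (m n : ℕ) : Set (MvPolynomial (Fin m) ℝ) :=
  {p | p.IsHomogeneous n ∧ ∀ r, 0 ≤ p.coeff r}

/-- The univariate polynomial `t ↦ p(x - t e)`. -/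
noncomputable def line {m : ℕ} (p : MvPolynomial (Fin m) ℝ) (e x : Fin m → ℝ) : Polynomial ℝ :=
  MvPolynomial.aeval (fun i => Polynomial.C (x i) - Polynomial.X * Polynomial.C (e i)) p

/-- `p` is homogeneous of degree `n`, `p(e) ≠ 0`, and for every real `x` the polynomial
`t ↦ p(x - t e)` has exactly `n` real roots, counted with multiplicity. -/
def IsHyperbolic {m : ℕ} (n : ℕ) (p : MvPolynomial (Fin m) ℝ) (e : Fin m → ℝ) : Prop :=
  p.IsHomogeneous n ∧ MvPolynomial.eval e p ≠ 0 ∧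
    ∀ x : Fin m → ℝ, Multiset.card (line p e x).roots = n

/-- The closed hyperbolic cone: the `x` for which all roots of `t ↦ p(x - t e)` are nonnegative. -/
def nonnegCone {m : ℕ} (p : MvPolynomial (Fin m) ℝ) (e : Fin m → ℝ) : Set (Fin m → ℝ) :=
  {x | ∀ t ∈ (line p e x).roots, 0 ≤ t}

/-- The all-ones vector. -/
def ones (m : ℕ) : Fin m → ℝ := fun _ => 1

/-- POS-hyperbolic polynomials of degree `n` in `m` variables: with `e` the all-ones vector,
`p(e) > 0`, `p` is `e`-hyperbolic, and the closed hyperbolic cone contains the nonnegative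
orthant. -/
def IsPOSHyperbolic {m : ℕ} (n : ℕ) (p : MvPolynomial (Fin m) ℝ) : Prop :=
  0 < MvPolynomial.eval (ones m) p ∧ IsHyperbolic n p (ones m) ∧
    {x : Fin m → ℝ | ∀ i, 0 ≤ x i} ⊆ nonnegCone p (ones m)

/-- The rank of `x`: the number of nonzero roots of `t ↦ q(x - t e)`, `e` the all-ones vector,
counted with multiplicity. -/
noncomputable def rank {m : ℕ} (q : MvPolynomial (Fin m) ℝ) (x : Fin m → ℝ) : ℕ :=
  Multiset.card ((line q (ones m) x).roots.filter (fun t => t ≠ 0))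

/-- The capacity: the infimum of `p` over positive vectors whose coordinates have product `1`. -/
noncomputable def cap {m : ℕ} (p : MvPolynomial (Fin m) ℝ) : ℝ :=
  sInf ((fun x : Fin m → ℝ => MvPolynomial.eval x p) '' {x | (∀ i, 0 < x i) ∧ ∏ i, x i = 1})

/-- The polynomial `p_{x_i}`: the derivative of `p` in `x_i`, evaluated at `x_i = 0`, as a
polynomial in the remaining variables (kept in their order). -/
noncomputable def derivAt {n : ℕ} (i : Fin (n + 1)) (p : MvPolynomial (Fin (n + 1)) ℝ) :
    MvPolynomial (Fin n) ℝ :=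
  MvPolynomial.aeval (i.insertNth (α := fun _ => MvPolynomial (Fin n) ℝ) 0 MvPolynomial.X)
    (MvPolynomial.pderiv i p)

/-- `S_p(A)`: the maximum over the support of `p` of `∑ i ∈ A, r_i` (and `0` if `p = 0`). -/
def suppDeg {m : ℕ} (p : MvPolynomial (Fin m) ℝ) (A : Finset (Fin m)) : ℕ :=
  p.support.sup (fun r => ∑ i ∈ A, r i)

/-- `g(k) = ((k-1)/k)^(k-1)` for `k ≥ 1`, and `g(0) = 1`. In particular `g(1) = 0^0 = 1`. -/
noncomputable def g (k : ℕ) : ℝ :=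
  if k = 0 then 1 else (((k : ℝ) - 1) / k) ^ (k - 1)

/-- VDW-families, stratified as `F 1, F 2, …` (the value `F 0` plays no role). -/
structure IsVDWFamily (F : (n : ℕ) → Set (MvPolynomial (Fin n) ℝ)) : Prop where
  subset_homPlus : ∀ n, 1 ≤ n → F n ⊆ HomPlus n n
  derivAt_mem : ∀ n, 1 ≤ n → ∀ p ∈ F (n + 1), ∀ i, derivAt i p ∈ F n
  cap_le : ∀ n, ∀ p ∈ F (n + 1), ∀ i, g (suppDeg p {i}) * cap p ≤ cap (derivAt i p)

/-- The POS-hyperbolic polynomials of degree `n` in `n` variables. -/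
def PHP (n : ℕ) : Set (MvPolynomial (Fin n) ℝ) := {p | IsPOSHyperbolic n p}

/-- The POS-hyperbolic polynomials of degree `n` in `n` variables with positive capacity. -/
def PHPPlus (n : ℕ) : Set (MvPolynomial (Fin n) ℝ) := {p | p ∈ PHP n ∧ 0 < cap p}

end VDW

/-! POS-hyperbolicity is equivalent to stability (`IsStable`): homogeneous, positive at the all-ones
vector, no zeros where all coordinates have positive real part. The hard direction,
`IsPOSHyperbolic.isStable`, deforms a real direction to zero and shows by a clopen argument that no
zero enters the upper half-plane.

Stability survives differentiation in a positive direction, by Gauss-Lucas. A partial derivative,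
and then its restriction to `x_i = 0`, is only a boundary case, and may vanish. `IsStableLimit`
handles this: its conditions are non-strict inequalities that pass to limits, and by
`eq_zero_or_isStable` a member is either zero or stable. This gives the dichotomy for `derivAt`,
and, by induction on the degree, nonnegative coefficients.

For the capacity bound, fix the other variables at a positive `x` with product 1 and let `R(t)` be
`p` with `x_i = t`. Then `R` is real-rooted with nonnegative coefficients, `R(t) ≥ cap(p) t` by
homogeneity, and `R'(0)` is the value of `derivAt i p` at `x`. If `R(0) > 0` and `k = deg R ≥ 1`,
AM-GM on the factors of `R` gives `R(t) ≤ R(0) (1 + t R'(0) / (k R(0)))^k`, and the best `t` yields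
`R'(0) ≥ g(k) cap(p)`. Here `k` is the degree of `p` in `x_i`, which equals the rank of `e_i`
(`IsStable.rank_single`). -/

namespace VDW

/-! ### Homogeneous polynomials restricted to lines, and directional derivatives -/

open Polynomial in
/-- The restriction `s ↦ p(x + s v)` of `p` to a line. -/
noncomputable def pencil {σ A : Type*} [CommRing A] [Algebra ℝ A] (x v : σ → A)
    (p : MvPolynomial σ ℝ) : Polynomial A :=
  MvPolynomial.aeval (fun j => C (x j) + X * C (v j)) p

theorem eval_aeval {σ A : Type*} [CommRing A] [Algebra ℝ A] (F : σ → Polynomial A) (s : A)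
    (p : MvPolynomial σ ℝ) :
    (MvPolynomial.aeval F p).eval s = MvPolynomial.aeval (fun j => (F j).eval s) p := by
  induction p using MvPolynomial.induction_on with
  | C a => simp [IsScalarTower.algebraMap_apply ℝ A (Polynomial A)]
  | add p q hp hq => simp [hp, hq]
  | mul_X p i hp => simp [hp]

theorem eval_pencil {σ A : Type*} [CommRing A] [Algebra ℝ A] (x v : σ → A) (s : A)
    (p : MvPolynomial σ ℝ) :
    (pencil x v p).eval s = MvPolynomial.aeval (fun j => x j + s * v j) p := by
  simp [pencil, eval_aeval, -Polynomial.X_mul_C]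

theorem aeval_smul_of_isHomogeneous {σ A : Type*} [CommRing A] [Algebra ℝ A]
    {p : MvPolynomial σ ℝ} {n : ℕ} (hp : p.IsHomogeneous n) (c : A) (z : σ → A) :
    MvPolynomial.aeval (fun j => c * z j) p = c ^ n * MvPolynomial.aeval z p := by
  simp only [MvPolynomial.aeval_def, MvPolynomial.eval₂_eq, Finset.mul_sum, mul_pow,
    Finset.prod_mul_distrib]
  refine Finset.sum_congr rfl fun d hd => ?_
  rw [Finset.prod_pow_eq_pow_sum, hp.degree_eq_sum_deg_support hd]
  ring

theorem natDegree_pencil_le {σ A : Type*} [CommRing A] [Algebra ℝ A] {p : MvPolynomial σ ℝ}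
    {n : ℕ} (hp : p.IsHomogeneous n) (x v : σ → A) : (pencil x v p).natDegree ≤ n := by
  rw [pencil, MvPolynomial.aeval_def, MvPolynomial.eval₂_eq]
  refine Polynomial.natDegree_sum_le_of_forall_le _ _ fun d hd => ?_
  rw [IsScalarTower.algebraMap_apply ℝ A (Polynomial A), ← Polynomial.C_eq_algebraMap]
  refine (Polynomial.natDegree_C_mul_le _ _).trans ((Polynomial.natDegree_prod_le _ _).trans ?_)
  rw [hp.degree_eq_sum_deg_support hd]
  refine Finset.sum_le_sum fun i _ => ?_
  refine (Polynomial.natDegree_pow_le_of_le _ (m := 1) ?_).trans (by simp)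
  compute_degree

/-- Homogeneity: `p(x + t v) = t^n p(v + t⁻¹ x)` for `t ≠ 0`, which is enough over an infinite
field. It turns leading coefficients into constant ones and, later, nonzero roots into a degree. -/
theorem reflect_pencil {σ A : Type*} [Field A] [Infinite A] [Algebra ℝ A] {p : MvPolynomial σ ℝ}
    {n : ℕ} (hp : p.IsHomogeneous n) (x v : σ → A) :
    (pencil v x p).reflect n = pencil x v p := by
  refine Polynomial.eq_of_infinite_eval_eq _ _
    ((Set.Finite.infinite_compl (Set.finite_singleton (0 : A))).mono fun t ht => ?_)
  have ht : t ≠ 0 := ht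
  let : Invertible (t⁻¹) := invertibleOfNonzero (inv_ne_zero ht)
  have h := Polynomial.eval₂_reflect_mul_pow (RingHom.id A) t⁻¹ n (pencil v x p)
    (natDegree_pencil_le hp v x)
  simp only [invOf_eq_inv, inv_inv, Polynomial.eval₂_id] at h
  rw [eval_pencil] at h
  rw [Set.mem_ofPred_eq, eval_pencil]
  have e : (fun j => x j + t * v j) = fun j => t * (v j + t⁻¹ * x j) := by
    ext j; field_simp; ring
  rw [e, aeval_smul_of_isHomogeneous hp, ← h, inv_pow]
  field_simp

theorem coeff_pencil {σ A : Type*} [Field A] [Infinite A] [Algebra ℝ A] {p : MvPolynomial σ ℝ}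
    {n : ℕ} (hp : p.IsHomogeneous n) (x v : σ → A) :
    (pencil x v p).coeff n = MvPolynomial.aeval v p := by
  rw [← reflect_pencil hp, Polynomial.coeff_reflect, Polynomial.revAt_le le_rfl, Nat.sub_self,
    Polynomial.coeff_zero_eq_eval_zero, eval_pencil]
  simp

theorem natDegree_pencil {σ A : Type*} [Field A] [Infinite A] [Algebra ℝ A]
    {p : MvPolynomial σ ℝ} {n : ℕ} (hp : p.IsHomogeneous n) (x v : σ → A)
    (hv : MvPolynomial.aeval v p ≠ 0) : (pencil x v p).natDegree = n :=
  Polynomial.natDegree_eq_of_le_of_coeff_ne_zero (natDegree_pencil_le hp x v)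
    (by rwa [coeff_pencil hp])

theorem derivative_aeval {σ A : Type*} [Fintype σ] [CommRing A] [Algebra ℝ A]
    (F : σ → Polynomial A) (p : MvPolynomial σ ℝ) :
    Polynomial.derivative (MvPolynomial.aeval F p) =
      ∑ i, MvPolynomial.aeval F (MvPolynomial.pderiv i p) * Polynomial.derivative (F i) := by
  classical
  induction p using MvPolynomial.induction_on with
  | C a => simp [IsScalarTower.algebraMap_apply ℝ A (Polynomial A)]
  | add p q hp hq => simp [hp, hq, add_mul, Finset.sum_add_distrib]
  | mul_X p i hp =>
    simp only [map_mul, MvPolynomial.aeval_X, Polynomial.derivative_mul, hp, Derivation.leibniz,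
      MvPolynomial.pderiv_X, smul_eq_mul, map_add, add_mul, Finset.sum_add_distrib]
    rw [add_comm]
    congr 1
    · simp [Pi.single_apply, apply_ite, ite_mul]
    · rw [Finset.sum_mul]
      exact Finset.sum_congr rfl fun j _ => by ring

/-- The directional derivative of `p` in direction `v`. -/
noncomputable def dirDeriv {σ : Type*} [Fintype σ] (v : σ → ℝ) (p : MvPolynomial σ ℝ) :
    MvPolynomial σ ℝ :=
  ∑ i, MvPolynomial.C (v i) * MvPolynomial.pderiv i p

theorem aeval_dirDeriv {σ A : Type*} [Fintype σ] [CommRing A] [Algebra ℝ A] (v : σ → ℝ)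
    (p : MvPolynomial σ ℝ) (z : σ → A) :
    MvPolynomial.aeval z (dirDeriv v p) =
      (Polynomial.derivative (pencil z (fun j => algebraMap ℝ A (v j)) p)).eval 0 := by
  rw [pencil, derivative_aeval, Polynomial.eval_finsetSum, dirDeriv, map_sum]
  refine Finset.sum_congr rfl fun i _ => ?_
  simp [eval_aeval, -Polynomial.X_mul_C, mul_comm]

/-! ### Passing between real and complex evaluation -/

theorem aeval_real {σ : Type*} (p : MvPolynomial σ ℝ) (x : σ → ℝ) :
    MvPolynomial.aeval x p = MvPolynomial.eval x p := by
  simp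

theorem ofReal_eval {σ : Type*} (p : MvPolynomial σ ℝ) (x : σ → ℝ) :
    MvPolynomial.aeval (fun j => (x j : ℂ)) p = ((MvPolynomial.eval x p : ℝ) : ℂ) := by
  have := MvPolynomial.aeval_algebraMap_apply (A := ℝ) ℂ x p
  simpa [MvPolynomial.coe_aeval_eq_eval, Function.comp_def] using this

theorem continuous_aeval {σ A X : Type*} [CommRing A] [Algebra ℝ A] [TopologicalSpace A]
    [IsTopologicalRing A] [TopologicalSpace X] (p : MvPolynomial σ ℝ) {f : X → σ → A}
    (hf : ∀ j, Continuous fun x => f x j) :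
    Continuous fun x => MvPolynomial.aeval (f x) p := by
  simp only [MvPolynomial.aeval_def, MvPolynomial.eval₂_eq]
  fun_prop

theorem splits_of_complex_roots_real {P : Polynomial ℝ}
    (h : ∀ s : ℂ, Polynomial.aeval s P = 0 → s.im = 0) : P.Splits := by
  rcases eq_or_ne P 0 with rfl | hP
  · exact Polynomial.Splits.zero
  refine Polynomial.Splits.of_splits_map (algebraMap ℝ ℂ) (IsAlgClosed.splits _) fun s hs => ?_
  have := h s (by simpa [hP] using hs)
  exact ⟨s.re, by simp [Complex.ext_iff, this]⟩

theorem im_eq_zero_of_splits {P : Polynomial ℝ} (hP : P.Splits) (h0 : P ≠ 0) {s : ℂ}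
    (hs : Polynomial.aeval s P = 0) : ∃ r : ℝ, r ∈ P.roots ∧ s = r := by
  have h1 : s ∈ (P.map (algebraMap ℝ ℂ)).roots := by
    simpa [h0] using hs
  rw [hP.roots_map] at h1
  obtain ⟨r, hr, rfl⟩ := Multiset.mem_map.1 h1
  exact ⟨r, hr, rfl⟩

theorem aeval_pencil {σ : Type*} (x v : σ → ℝ) (p : MvPolynomial σ ℝ) (s : ℂ) :
    Polynomial.aeval s (pencil x v p) = MvPolynomial.aeval (fun j => (x j : ℂ) + s * v j) p := by
  induction p using MvPolynomial.induction_on with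
  | C a => simp [pencil]
  | add p q hp hq => simp_all [pencil]
  | mul_X p i hp => simp_all [pencil, -Polynomial.X_mul_C]

theorem line_eq_pencil {m : ℕ} (p : MvPolynomial (Fin m) ℝ) (e x : Fin m → ℝ) :
    line p e x = pencil x (fun j => -e j) p := by
  simp [line, pencil, sub_eq_add_neg]

/-! ### Stable polynomials and their limits -/

/-- Homogeneous of degree `n`, positive at the all-ones vector, and without zeros in the product
of open right half-planes. -/
structure IsStable {σ : Type*} (n : ℕ) (p : MvPolynomial σ ℝ) : Prop where
  homog : p.IsHomogeneous n
  pos_one : 0 < MvPolynomial.eval (fun _ => 1) p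
  ne_zero : ∀ z : σ → ℂ, (∀ i, 0 < (z i).re) → MvPolynomial.aeval z p ≠ 0

/-- A class of homogeneous polynomials that is closed under limits; its nonzero members are the
stable polynomials. -/
structure IsStableLimit {σ : Type*} (n : ℕ) (p : MvPolynomial σ ℝ) : Prop where
  homog : p.IsHomogeneous n
  nonneg : ∀ x : σ → ℝ, (∀ i, 0 ≤ x i) → 0 ≤ MvPolynomial.eval x p
  mono : ∀ x y : σ → ℝ, (∀ i, 0 ≤ x i) → (∀ i, x i ≤ y i) →
    MvPolynomial.eval x p ≤ MvPolynomial.eval y p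
  le_norm : ∀ z : σ → ℂ, (∀ i, 0 ≤ (z i).re) →
    MvPolynomial.eval (fun i => (z i).re) p ≤ ‖MvPolynomial.aeval z p‖

theorem le_of_forall_pos_le {f g : ℝ → ℝ} (hf : Continuous f) (hg : Continuous g)
    (h : ∀ ε, 0 < ε → f ε ≤ g ε) : f 0 ≤ g 0 := by
  have hc : IsClosed {ε | f ε ≤ g ε} := isClosed_le hf hg
  have hs : Set.Ioi (0 : ℝ) ⊆ {ε | f ε ≤ g ε} := fun ε hε => h ε hε
  have h0 : (0 : ℝ) ∈ closure (Set.Ioi 0) := by rw [closure_Ioi]; exact Set.self_mem_Ici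
  exact hc.closure_subset_iff.2 hs h0

theorem continuous_eval {σ X : Type*} [TopologicalSpace X] (p : MvPolynomial σ ℝ) {f : X → σ → ℝ}
    (hf : ∀ j, Continuous fun x => f x j) : Continuous fun x => MvPolynomial.eval (f x) p := by
  have := continuous_aeval p hf
  simpa [aeval_real] using this

/-- Factor by factor: `|0 - r| ≤ |i - r|` for real `r`. Applied to `s ↦ p(Re z + s Im z)`, it
compares `p(Re z)` with `p(z)`. -/
theorem abs_eval_zero_le_norm_aeval_I {P : Polynomial ℝ} (hP : P.Splits) :
    |P.eval 0| ≤ ‖Polynomial.aeval Complex.I P‖ := by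
  obtain ⟨m, hm⟩ := Polynomial.splits_iff_exists_multiset.1 hP
  rw [hm]
  clear hm
  generalize P.leadingCoeff = a
  induction m using Multiset.induction_on with
  | empty => simp
  | cons r m ih =>
    simp only [Multiset.map_cons, Multiset.prod_cons, mul_left_comm (Polynomial.C a)] at ih ⊢
    rw [Polynomial.eval_mul, map_mul, abs_mul, norm_mul]
    refine mul_le_mul ?_ ih (abs_nonneg _) (norm_nonneg _)
    have := Complex.abs_re_le_norm (Polynomial.aeval Complex.I (Polynomial.X - Polynomial.C r))
    simpa using this

theorem dirDeriv_single {σ : Type*} [Fintype σ] [DecidableEq σ] (i : σ) (p : MvPolynomial σ ℝ) :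
    dirDeriv (Pi.single i 1) p = MvPolynomial.pderiv i p := by
  simp [dirDeriv, Pi.single_apply, apply_ite, ite_mul]

namespace IsStable

variable {σ : Type*} {n : ℕ} {p : MvPolynomial σ ℝ}

/-- By homogeneity, rotating all coordinates together preserves nonvanishing, so any open half-plane
bounded by a line through 0 serves as well. -/
theorem aeval_ne_zero_of_mul (hp : IsStable n p) (c : ℂ) (z : σ → ℂ)
    (h : ∀ j, 0 < (c * z j).re) : MvPolynomial.aeval z p ≠ 0 := by
  intro h0
  apply hp.ne_zero _ h
  rw [aeval_smul_of_isHomogeneous hp.homog, h0, mul_zero]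

theorem eval_ne_zero (hp : IsStable n p) {x : σ → ℝ} (hx : ∀ i, 0 < x i) :
    MvPolynomial.eval x p ≠ 0 := by
  have := hp.ne_zero (fun j => (x j : ℂ)) (by simpa using hx)
  rw [ofReal_eval] at this
  exact_mod_cast this

theorem eval_pos (hp : IsStable n p) {x : σ → ℝ} (hx : ∀ i, 0 < x i) :
    0 < MvPolynomial.eval x p := by
  by_contra! hneg
  have hc : Continuous fun s : ℝ => MvPolynomial.eval (fun j => (1 - s) + s * x j) p :=
    continuous_eval p fun j => by fun_prop
  obtain ⟨s, ⟨hs0, hs1⟩, hs⟩ := intermediate_value_Icc' (zero_le_one (α := ℝ)) hc.continuousOn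
    (show (0 : ℝ) ∈ Set.Icc _ _ by
      constructor
      · simpa using hneg
      · simpa using hp.pos_one.le)
  refine hp.eval_ne_zero (fun j => ?_) hs
  rcases hs0.eq_or_lt with rfl | h
  · simp
  · have := mul_pos h (hx j); linarith

theorem splits_pencil (hp : IsStable n p) {x : σ → ℝ} (hx : ∀ i, 0 < x i) (y : σ → ℝ) :
    (pencil x y p).Splits := by
  refine splits_of_complex_roots_real fun s hs => ?_
  rw [aeval_pencil] at hs
  by_contra him
  -- Multiplying `x + s y` by `∓i s̄` makes the `y`-part purely imaginary and leaves real part `|Im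
  -- s| x_j > 0`.
  rcases lt_or_gt_of_ne him with h | h
  · refine hp.aeval_ne_zero_of_mul (-Complex.I * (starRingEnd ℂ) s) _ (fun j => ?_) hs
    have := mul_pos (neg_pos.2 h) (hx j)
    simp
    nlinarith
  · refine hp.aeval_ne_zero_of_mul (Complex.I * (starRingEnd ℂ) s) _ (fun j => ?_) hs
    have := mul_pos h (hx j)
    simp
    nlinarith

theorem roots_pencil_neg (hp : IsStable n p) {x v : σ → ℝ} (hx : ∀ i, 0 < x i)
    (hv : ∀ i, 0 ≤ v i) : ∀ r ∈ (pencil x v p).roots, r < 0 := by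
  intro r hr
  by_contra! hr0
  have := (Polynomial.mem_roots'.1 hr).2
  rw [Polynomial.IsRoot, eval_pencil, aeval_real] at this
  exact hp.eval_ne_zero (fun j => add_pos_of_pos_of_nonneg (hx j) (mul_nonneg hr0 (hv j))) this

theorem eval_pencil_zero_pos (hp : IsStable n p) {x : σ → ℝ} (hx : ∀ i, 0 < x i) (v : σ → ℝ) :
    0 < (pencil x v p).eval 0 := by
  simpa [eval_pencil, aeval_real] using hp.eval_pos hx

/-- Along the line all roots are negative and the leading coefficient is positive, so every factor
`s - r` grows from `s = 0` to `s = 1`. -/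
theorem eval_le_eval_add (hp : IsStable n p) {x v : σ → ℝ} (hx : ∀ i, 0 < x i)
    (hv : ∀ i, 0 ≤ v i) : MvPolynomial.eval x p ≤ MvPolynomial.eval (fun j => x j + v j) p := by
  have hr := hp.roots_pencil_neg hx hv
  have h0 := hp.eval_pencil_zero_pos hx v
  have hs := hp.splits_pencil hx v
  have e0 : MvPolynomial.eval x p = (pencil x v p).eval 0 := by
    simp [eval_pencil]
  have e1 : MvPolynomial.eval (fun j => x j + v j) p = (pencil x v p).eval 1 := by
    simp [eval_pencil]
  rw [e0, e1]
  rw [hs.eval_eq_prod_roots] at h0 ⊢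
  rw [hs.eval_eq_prod_roots]
  have hpos : 0 < ((pencil x v p).roots.map (fun r => 0 - r)).prod := by
    refine Multiset.prod_pos fun a ha => ?_
    obtain ⟨r, hr', rfl⟩ := Multiset.mem_map.1 ha
    linarith [hr r hr']
  refine mul_le_mul_of_nonneg_left ?_ (pos_of_mul_pos_left h0 hpos.le).le
  refine Multiset.prod_map_le_prod_map₀ _ _ (fun r hr' => ?_) fun r _ => ?_
  · linarith [hr r hr']
  · linarith

theorem isStableLimit (hp : IsStable n p) : IsStableLimit n p where
  homog := hp.homog
  nonneg x hx := by
    have := le_of_forall_pos_le (f := fun _ => 0)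
      (g := fun ε => MvPolynomial.eval (fun j => x j + ε) p) continuous_const
      (continuous_eval p fun j => by fun_prop)
      fun ε hε => (hp.eval_pos fun j => add_pos_of_nonneg_of_pos (hx j) hε).le
    simpa using this
  mono x y hx hxy := by
    have := le_of_forall_pos_le
      (f := fun ε => MvPolynomial.eval (fun j => x j + ε) p)
      (g := fun ε => MvPolynomial.eval (fun j => y j + ε) p)
      (continuous_eval p fun j => by fun_prop) (continuous_eval p fun j => by fun_prop)
      fun ε hε => by
        have := hp.eval_le_eval_add (x := fun j => x j + ε) (v := fun j => y j - x j)
          (fun j => add_pos_of_nonneg_of_pos (hx j) hε) fun j => sub_nonneg.2 (hxy j)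
        refine this.trans_eq ?_
        congr 2
        ext j
        ring
    simpa using this
  le_norm z hz := by
    have := le_of_forall_pos_le
      (f := fun ε => MvPolynomial.eval (fun j => (z j).re + ε) p)
      (g := fun ε => ‖MvPolynomial.aeval (fun j => z j + (ε : ℂ)) p‖)
      (continuous_eval p fun j => by fun_prop)
      (continuous_aeval p fun j => by fun_prop).norm
      fun ε hε => by
        have hx : ∀ j, 0 < (z j).re + ε := fun j => add_pos_of_nonneg_of_pos (hz j) hε
        have := abs_eval_zero_le_norm_aeval_I (hp.splits_pencil hx fun j => (z j).im)
        rw [aeval_pencil, eval_pencil, aeval_real] at this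
        simp only [zero_mul, add_zero] at this
        refine (le_abs_self _).trans (this.trans_eq ?_)
        congr 3
        ext j
        apply Complex.ext <;> simp
    simpa using this

theorem dirDeriv [Fintype σ] {p : MvPolynomial σ ℝ} (hp : IsStable (n + 1) p) {v : σ → ℝ}
    (hv : ∀ i, 0 < v i) : IsStable n (dirDeriv v p) := by
  have hne : ∀ z : σ → ℂ, (∀ i, 0 < (z i).re) → MvPolynomial.aeval z (VDW.dirDeriv v p) ≠ 0 := by
    intro z hz h0
    rw [aeval_dirDeriv] at h0
    set F := pencil z (fun j => algebraMap ℝ ℂ (v j)) p with hF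
    have hc : MvPolynomial.aeval (fun j => algebraMap ℝ ℂ (v j)) p ≠ 0 :=
      hp.ne_zero _ (by simpa using hv)
    have hdeg : F.natDegree = n + 1 := natDegree_pencil hp.homog _ _ hc
    have hF' : Polynomial.derivative F ≠ 0 := by
      intro h
      have := Polynomial.derivative_eq_zero.1 h
      omega
    have hmem : (0 : ℂ) ∈ (Polynomial.derivative F).rootSet ℂ :=
      Polynomial.mem_rootSet.2 ⟨hF', by simpa [Polynomial.coe_aeval_eq_eval] using h0⟩
    -- A root with `Re s ≥ 0` would put `z + s v` in the right half-planes. Gauss-Lucas then keeps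
    -- the roots of `F'` in the open left half-plane, away from 0.
    have hsub : F.rootSet ℂ ⊆ {s : ℂ | s.re < 0} := by
      intro s hs
      have hs' := (Polynomial.mem_rootSet.1 hs).2
      rw [Polynomial.coe_aeval_eq_eval, hF, eval_pencil] at hs'
      by_contra! hre
      have hre : 0 ≤ s.re := by simpa using hre
      refine hp.ne_zero _ (fun j => ?_) hs'
      have := mul_nonneg hre (hv j).le
      simp
      linarith [hz j]
    have := convexHull_min hsub (convex_halfSpace_re_lt 0)
      (Polynomial.rootSet_derivative_subset_convexHull_rootSet
        (Polynomial.natDegree_pos_iff_degree_pos.1 (by omega)) hmem)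
    simp at this
  refine ⟨?_, ?_, hne⟩
  · refine MvPolynomial.IsHomogeneous.sum _ _ _ fun i _ => ?_
    exact (hp.homog.pderiv).C_mul _
  · refine lt_of_le_of_ne ?_ (Ne.symm ?_)
    · have h := aeval_dirDeriv v p (fun _ : σ => (1 : ℝ))
      rw [aeval_real] at h
      simp only [Algebra.algebraMap_self, RingHom.id_apply] at h
      have hx : ∀ i : σ, (0 : ℝ) < (fun _ : σ => (1 : ℝ)) i := fun _ => one_pos
      have h0 := hp.eval_pencil_zero_pos hx v
      refine le_of_le_of_eq ?_ h.symm
      rw [(hp.splits_pencil hx v).eval_derivative_eq_eval_mul_sum h0.ne']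
      refine mul_nonneg h0.le (Multiset.sum_nonneg fun a ha => ?_)
      obtain ⟨r, hr, rfl⟩ := Multiset.mem_map.1 ha
      have := hp.roots_pencil_neg hx (fun i => (hv i).le) r hr
      exact one_div_nonneg.2 (by linarith)
    · intro h
      apply hne (fun _ => ((1 : ℝ) : ℂ)) (by simp)
      rw [ofReal_eval, h, Complex.ofReal_zero]

theorem isStableLimit_pderiv [Fintype σ] {p : MvPolynomial σ ℝ} (hp : IsStable (n + 1) p)
    (i : σ) : IsStableLimit n (MvPolynomial.pderiv i p) := by
  classical
  -- The direction `e_i` is on the boundary of the positive orthant; it is approached through `e_i +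
  -- ε (1, …, 1)`.
  have hlim : ∀ ε : ℝ, 0 < ε →
      IsStableLimit n (VDW.dirDeriv (fun j => (Pi.single i 1 : σ → ℝ) j + ε) p) :=
    fun ε hε => (hp.dirDeriv fun j => add_pos_of_nonneg_of_pos (by
      rw [Pi.single_apply]; split_ifs <;> norm_num) hε).isStableLimit
  have h0 : VDW.dirDeriv (fun j => (Pi.single i 1 : σ → ℝ) j + 0) p = MvPolynomial.pderiv i p := by
    simp only [add_zero]
    exact dirDeriv_single i p
  have hcr : ∀ x : σ → ℝ, Continuous fun ε : ℝ =>
      MvPolynomial.eval x (VDW.dirDeriv (fun j => (Pi.single i 1 : σ → ℝ) j + ε) p) := by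
    intro x
    simp only [VDW.dirDeriv, map_sum, map_mul, MvPolynomial.eval_C]
    fun_prop
  have hcc : ∀ z : σ → ℂ, Continuous fun ε : ℝ =>
      MvPolynomial.aeval z (VDW.dirDeriv (fun j => (Pi.single i 1 : σ → ℝ) j + ε) p) := by
    intro z
    simp only [VDW.dirDeriv, map_sum, map_mul, MvPolynomial.aeval_C, Complex.coe_algebraMap]
    fun_prop
  rw [← h0]
  refine ⟨?_, fun x hx => ?_, fun x y hx hxy => ?_, fun z hz => ?_⟩
  · rw [h0]
    exact hp.homog.pderiv
  · exact le_of_forall_pos_le continuous_const (hcr x) fun ε hε => (hlim ε hε).nonneg x hx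
  · exact le_of_forall_pos_le (hcr x) (hcr y) fun ε hε => (hlim ε hε).mono x y hx hxy
  · exact le_of_forall_pos_le (hcr _) (hcc z).norm fun ε hε => (hlim ε hε).le_norm z hz

end IsStable

namespace IsStableLimit

variable {σ : Type*} {n : ℕ} {p : MvPolynomial σ ℝ}

theorem zero : IsStableLimit n (0 : MvPolynomial σ ℝ) :=
  ⟨MvPolynomial.isHomogeneous_zero _ _ _, by simp, by simp, by simp⟩

/-- The value at the all-ones vector decides. If it is 0, monotonicity and homogeneity force `p = 0`
on the nonnegative orthant. If it is positive, then `|p(z)| ≥ p(Re z) ≥ c^n p(1, …, 1) > 0` with `c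
= min Re z_j`. -/
theorem eq_zero_or_isStable [Finite σ] (hp : IsStableLimit n p) : p = 0 ∨ IsStable n p := by
  cases nonempty_fintype σ
  have hscale : ∀ c : ℝ, MvPolynomial.eval (fun _ => c) p =
      c ^ n * MvPolynomial.eval (fun _ => 1) p := fun c => by
    simpa [aeval_real] using
      aeval_smul_of_isHomogeneous hp.homog c (fun _ => (1 : ℝ))
  rcases (hp.nonneg (fun _ => 1) fun _ => zero_le_one).eq_or_lt with h | h
  · left
    refine MvPolynomial.funext_set (fun _ => Set.Ici (0 : ℝ)) (fun _ => Set.Ici_infinite 0)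
      fun x hx => ?_
    have hx : ∀ j, 0 ≤ x j := fun j => hx j trivial
    rw [map_zero]
    refine le_antisymm ?_ (hp.nonneg x hx)
    refine (hp.mono x (fun _ => ∑ j, x j) hx
      fun j => Finset.single_le_sum (fun j _ => hx j) (Finset.mem_univ j)).trans ?_
    rw [hscale, ← h, mul_zero]
  · right
    refine ⟨hp.homog, h, fun z hz h0 => ?_⟩
    obtain ⟨c, hc, hcz⟩ : ∃ c : ℝ, 0 < c ∧ ∀ j, c ≤ (z j).re := by
      rcases isEmpty_or_nonempty σ with hσ | hσ
      · exact ⟨1, one_pos, fun j => hσ.elim j⟩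
      · obtain ⟨j, hj⟩ := Finite.exists_min fun j => (z j).re
        exact ⟨_, hz j, hj⟩
    have h1 := hp.mono (fun _ => c) (fun j => (z j).re) (fun _ => hc.le) hcz
    have h2 := hp.le_norm z fun j => (hz j).le
    rw [hscale] at h1
    rw [h0, norm_zero] at h2
    have := mul_pos (pow_pos hc n) h
    linarith

theorem pderiv [Finite σ] (hp : IsStableLimit (n + 1) p) (i : σ) :
    IsStableLimit n (MvPolynomial.pderiv i p) := by
  cases nonempty_fintype σ
  rcases hp.eq_zero_or_isStable with rfl | h
  · rw [map_zero]; exact zero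
  · exact h.isStableLimit_pderiv i

/-- Induction on the degree: `r_i` times the coefficient at `r` is the coefficient of `∂_i p` at `r
- e_i`. -/
theorem coeff_nonneg [Finite σ] (hp : IsStableLimit n p) (r : σ →₀ ℕ) : 0 ≤ p.coeff r := by
  classical
  induction n generalizing p r with
  | zero =>
    by_cases hr : r = 0
    · subst hr
      have := hp.nonneg (fun _ => 0) fun _ => le_rfl
      rwa [show (fun _ : σ => (0 : ℝ)) = 0 from rfl, MvPolynomial.eval_zero] at this
    · refine (hp.homog.coeff_eq_zero ?_).ge
      simpa [Finsupp.degree_eq_zero_iff] using hr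
  | succ n ih =>
    by_cases hr : r = 0
    · subst hr
      exact (hp.homog.coeff_eq_zero (by simp)).ge
    · obtain ⟨i, hi⟩ := Finsupp.ne_iff.1 hr
      have hi : 1 ≤ r i := Nat.one_le_iff_ne_zero.2 hi
      have hle : Finsupp.single i 1 ≤ r := Finsupp.single_le_iff.2 hi
      have h := ih (hp.pderiv i) (r - Finsupp.single i 1)
      rw [MvPolynomial.coeff_pderiv, tsub_add_cancel_of_le hle] at h
      refine nonneg_of_mul_nonneg_left h ?_
      positivity

end IsStableLimit

/-! ### Equivalence of POS-hyperbolicity and stability -/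

/-- Each factor satisfies `|s - r| ≥ Im s`. The bound does not involve the roots, so it turns
nonvanishing into a closed condition. -/
theorem norm_leadingCoeff_mul_im_pow_le {F : Polynomial ℂ} (hF : ∀ r ∈ F.roots, r.im ≤ 0) {s : ℂ}
    (hs : 0 < s.im) : ‖F.leadingCoeff‖ * s.im ^ F.natDegree ≤ ‖F.eval s‖ := by
  have hsp : F.Splits := IsAlgClosed.splits F
  rw [hsp.eval_eq_prod_roots, norm_mul, hsp.natDegree_eq_card_roots]
  refine mul_le_mul_of_nonneg_left ?_ (norm_nonneg _)
  generalize F.roots = m at hF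
  induction m using Multiset.induction_on with
  | empty => simp
  | cons r m ih =>
    simp only [Multiset.card_cons, pow_succ', Multiset.map_cons, Multiset.prod_cons, norm_mul]
    refine mul_le_mul ?_ (ih fun r hr => hF r (Multiset.mem_cons_of_mem hr)) (by positivity)
      (norm_nonneg _)
    have h1 := hF r (Multiset.mem_cons_self r m)
    have h2 := (le_abs_self _).trans (Complex.abs_im_le_norm (s - r))
    rw [Complex.sub_im] at h2
    linarith

theorem aeval_neg_ones_ne_zero {m n : ℕ} {p : MvPolynomial (Fin m) ℝ} (hp : p.IsHomogeneous n)
    (h1 : MvPolynomial.eval (ones m) p ≠ 0) :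
    MvPolynomial.aeval (fun j => -ones m j) p ≠ 0 := by
  have h := aeval_smul_of_isHomogeneous hp (-1) (ones m)
  simp only [neg_mul, one_mul] at h
  rw [h, aeval_real]
  exact mul_ne_zero (pow_ne_zero _ (by norm_num)) h1

namespace IsHyperbolic

variable {m n : ℕ} {q : MvPolynomial (Fin m) ℝ}

theorem natDegree_line (hq : IsHyperbolic n q (ones m)) (x : Fin m → ℝ) :
    (line q (ones m) x).natDegree = n := by
  rw [line_eq_pencil]
  exact natDegree_pencil hq.1 _ _ (aeval_neg_ones_ne_zero hq.1 hq.2.1)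

theorem line_ne_zero (hq : IsHyperbolic n q (ones m)) (x : Fin m → ℝ) :
    line q (ones m) x ≠ 0 := by
  intro h0
  have hc : (line q (ones m) x).coeff n ≠ 0 := by
    rw [line_eq_pencil, coeff_pencil hq.1]
    exact aeval_neg_ones_ne_zero hq.1 hq.2.1
  exact hc (by rw [h0, Polynomial.coeff_zero])

theorem exists_root (hq : IsHyperbolic n q (ones m)) (x : Fin m → ℝ) (w : ℂ)
    (h : MvPolynomial.aeval (fun j => (x j : ℂ) + w) q = 0) :
    ∃ r ∈ (line q (ones m) x).roots, w = -(r : ℂ) := by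
  have hs : (line q (ones m) x).Splits :=
    Polynomial.splits_iff_card_roots.2 ((hq.2.2 x).trans (hq.natDegree_line x).symm)
  have h0 : Polynomial.aeval (-w) (line q (ones m) x) = 0 := by
    rw [line_eq_pencil, aeval_pencil, ← h]
    simp [ones]
  obtain ⟨r, hr, hw⟩ := im_eq_zero_of_splits hs (hq.line_ne_zero x) h0
  exact ⟨r, hr, by rw [← hw, neg_neg]⟩

theorem aeval_add_ne_zero (hq : IsHyperbolic n q (ones m)) (x : Fin m → ℝ) {w : ℂ}
    (hw : w.im ≠ 0) : MvPolynomial.aeval (fun j => (x j : ℂ) + w) q ≠ 0 := by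
  intro h
  obtain ⟨r, -, rfl⟩ := hq.exists_root x w h
  simp at hw

end IsHyperbolic

/-- The closed upper half-plane is compactified to a half-disc by `s = u / (1 - |u|)`. After
homogenizing, the arc `|u| = 1` stands for `s = ∞`, where `q(u a) ≠ 0`; compactness then gives a
neighbourhood of `β₀` uniform in `s`. -/
theorem isOpen_setOf_forall_im_nonneg {σ : Type*} {n : ℕ} {q : MvPolynomial σ ℝ}
    (hq : q.IsHomogeneous n) (b : ℝ → σ → ℂ) (hb : ∀ j, Continuous fun β => b β j) (a : σ → ℂ)
    (ha : MvPolynomial.aeval a q ≠ 0) :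
    IsOpen {β : ℝ | ∀ s : ℂ, 0 ≤ s.im → MvPolynomial.aeval (fun j => b β j + s * a j) q ≠ 0} := by
  rw [isOpen_iff_mem_nhds]
  intro β₀ hβ₀
  have hK : IsCompact (Metric.closedBall (0 : ℂ) 1 ∩ {u | 0 ≤ u.im}) :=
    (isCompact_closedBall 0 1).inter_right (isClosed_le continuous_const Complex.continuous_im)
  have hG : Continuous fun z : ℝ × ℂ =>
      MvPolynomial.aeval (fun j => ((1 - ‖z.2‖ : ℝ) : ℂ) * b z.1 j + z.2 * a j) q :=
    continuous_aeval q fun j => by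
      have : Continuous fun z : ℝ × ℂ => b z.1 j := (hb j).comp continuous_fst
      fun_prop
  have hev := hK.eventually_forall_of_forall_eventually (x₀ := β₀)
    (P := fun β u => MvPolynomial.aeval (fun j => ((1 - ‖u‖ : ℝ) : ℂ) * b β j + u * a j) q ≠ 0)
    fun u hu => by
      refine hG.continuousAt.eventually_ne ?_
      have hu1 : ‖u‖ ≤ 1 := by simpa using hu.1
      rcases hu1.eq_or_lt with h1 | h1
      · simp only [h1, sub_self, Complex.ofReal_zero, zero_mul, zero_add]
        rw [aeval_smul_of_isHomogeneous hq]
        refine mul_ne_zero (pow_ne_zero _ ?_) ha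
        rintro rfl
        simp at h1
      · have hc : ((1 - ‖u‖ : ℝ) : ℂ) ≠ 0 := by
          exact_mod_cast (sub_pos.2 h1).ne'
        have h := hβ₀ (u / ((1 - ‖u‖ : ℝ) : ℂ)) (by
          rw [Complex.div_ofReal_im]
          exact div_nonneg hu.2 (sub_pos.2 h1).le)
        have e : (fun j => ((1 - ‖u‖ : ℝ) : ℂ) * b β₀ j + u * a j) =
            fun j => ((1 - ‖u‖ : ℝ) : ℂ) * (b β₀ j + u / ((1 - ‖u‖ : ℝ) : ℂ) * a j) := by
          ext j
          field_simp
        simp only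
        rw [e, aeval_smul_of_isHomogeneous hq]
        exact mul_ne_zero (pow_ne_zero _ hc) h
  filter_upwards [hev] with β hβ s hs h0
  have hp : 0 < 1 + ‖s‖ := by positivity
  have hn : ‖s / ((1 + ‖s‖ : ℝ) : ℂ)‖ = ‖s‖ / (1 + ‖s‖) := by
    rw [norm_div, Complex.norm_real, Real.norm_of_nonneg hp.le]
  have hc : ((1 + ‖s‖ : ℝ) : ℂ) ≠ 0 := by exact_mod_cast hp.ne'
  refine hβ (s / ((1 + ‖s‖ : ℝ) : ℂ)) ⟨?_, ?_⟩ ?_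
  · rw [mem_closedBall_zero_iff, hn, div_le_one hp]
    linarith
  · change 0 ≤ (s / ((1 + ‖s‖ : ℝ) : ℂ)).im
    rw [Complex.div_ofReal_im]
    exact div_nonneg hs hp.le
  · have e : (fun j => ((1 - ‖s / ((1 + ‖s‖ : ℝ) : ℂ)‖ : ℝ) : ℂ) * b β j +
        s / ((1 + ‖s‖ : ℝ) : ℂ) * a j) =
        fun j => ((1 + ‖s‖ : ℝ) : ℂ)⁻¹ * (b β j + s * a j) := by
      ext j
      have : (1 - ‖s / ((1 + ‖s‖ : ℝ) : ℂ)‖ : ℝ) = (1 + ‖s‖)⁻¹ := by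
        rw [hn]; field_simp; ring
      rw [this, Complex.ofReal_inv]
      field_simp
    rw [e, aeval_smul_of_isHomogeneous hq, h0, mul_zero]

namespace IsPOSHyperbolic

variable {m n : ℕ} {q : MvPolynomial (Fin m) ℝ}

theorem roots_nonneg (hq : IsPOSHyperbolic n q) {x : Fin m → ℝ} (hx : ∀ i, 0 ≤ x i) :
    ∀ r ∈ (line q (ones m) x).roots, 0 ≤ r :=
  hq.2.2 (show x ∈ {x : Fin m → ℝ | ∀ i, 0 ≤ x i} from hx)

theorem eval_ne_zero (hq : IsPOSHyperbolic n q) {a : Fin m → ℝ} {τ : ℝ} (hτ : 0 < τ)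
    (ha : ∀ j, τ ≤ a j) : MvPolynomial.eval a q ≠ 0 := by
  intro h0
  obtain ⟨r, hr, hτr⟩ := hq.2.1.exists_root (fun j => a j - τ) τ (by
    have := ofReal_eval q a
    rw [h0] at this
    simpa using this)
  have h1 : τ = -r := by exact_mod_cast hτr
  have h2 := hq.roots_nonneg (x := fun j => a j - τ) (fun j => sub_nonneg.2 (ha j)) r hr
  linarith

/-- Replace `x` by `β x`. The good `β` form a clopen subset of `ℝ` containing 0, hence contain 1:
real `s` is never a zero, because `iτ` shifts a real vector off the real roots. -/
theorem aeval_add_smul_ne_zero (hq : IsPOSHyperbolic n q) (x : Fin m → ℝ) {a : Fin m → ℝ} {τ : ℝ}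
    (hτ : 0 < τ) (ha : ∀ j, τ ≤ a j) (s : ℂ) (hs : 0 ≤ s.im) :
    MvPolynomial.aeval (fun j => (x j : ℂ) + Complex.I * τ + s * a j) q ≠ 0 := by
  have hhom := hq.2.1.1
  have hIτ : (Complex.I * τ).im ≠ 0 := by simpa using hτ.ne'
  have hqa : MvPolynomial.aeval (fun j => (a j : ℂ)) q ≠ 0 := by
    rw [ofReal_eval]
    exact_mod_cast hq.eval_ne_zero hτ ha
  set b : ℝ → Fin m → ℂ := fun β j => (β * x j : ℝ) + Complex.I * τ with hb
  set A : Set ℝ := {β : ℝ | ∀ s : ℂ, 0 ≤ s.im →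
    MvPolynomial.aeval (fun j => b β j + s * (a j : ℂ)) q ≠ 0} with hA
  have hbc : ∀ j, Continuous fun β => b β j := fun j => by fun_prop
  have hreal : ∀ (β : ℝ) (s : ℂ), s.im = 0 →
      MvPolynomial.aeval (fun j => b β j + s * (a j : ℂ)) q ≠ 0 := by
    intro β s hs
    obtain ⟨s, rfl⟩ : ∃ r : ℝ, s = r := ⟨s.re, by simp [Complex.ext_iff, hs]⟩
    convert hq.2.1.aeval_add_ne_zero (fun j => β * x j + s * a j) hIτ using 4 with j
    simp [hb]
    ring
  have hopen : IsOpen A := isOpen_setOf_forall_im_nonneg hhom b hbc _ hqa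
  have hclosed : IsClosed A := by
    have : A = ⋂ s : ℂ, ⋂ _ : 0 < s.im,
        {β : ℝ | ‖MvPolynomial.aeval (fun j => (a j : ℂ)) q‖ * s.im ^ n ≤
          ‖MvPolynomial.aeval (fun j => b β j + s * (a j : ℂ)) q‖} := by
      ext β
      simp only [Set.mem_iInter]
      constructor
      · intro hβ s hs
        have hdeg := natDegree_pencil hhom (b β) _ hqa
        have := norm_leadingCoeff_mul_im_pow_le (F := pencil (b β) (fun j => (a j : ℂ)) q)
          (fun r hr => by
            by_contra! h
            have hr' := (Polynomial.mem_roots'.1 hr).2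
            rw [Polynomial.IsRoot, eval_pencil] at hr'
            exact hβ r h.le hr') hs
        rwa [Polynomial.leadingCoeff, hdeg, coeff_pencil hhom, eval_pencil] at this
      · intro hβ s hs
        rcases hs.eq_or_lt with h | h
        · exact hreal β s h.symm
        · intro h0
          have h1 := hβ s h
          rw [Set.mem_ofPred_eq, h0, norm_zero] at h1
          have := mul_pos (norm_pos_iff.2 hqa) (pow_pos h n)
          linarith
    rw [this]
    refine isClosed_iInter fun s => isClosed_iInter fun _ => isClosed_le continuous_const ?_
    exact (continuous_aeval q fun j => (hbc j).add continuous_const).norm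
  have h0 : (0 : ℝ) ∈ A := by
    intro s hs
    rcases hs.eq_or_lt with h | h
    · exact hreal 0 s h.symm
    · intro h0
      have hs0 : s ≠ 0 := by rintro rfl; simp at h
      -- At `β = 0`, dividing by `s` leaves `q(a + (iτ/s)(1, …, 1))`. A zero means `iτ = -r s` with
      -- `r ≥ 0`, impossible since `τ > 0` and `Im s > 0`.
      have e : (fun j => b 0 j + s * (a j : ℂ)) =
          fun j => s * ((a j : ℂ) + Complex.I * τ / s) := by
        ext j
        simp only [hb, zero_mul, Complex.ofReal_zero, zero_add]
        field_simp
        ring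
      rw [e, aeval_smul_of_isHomogeneous hhom] at h0
      obtain ⟨r, hr, hw⟩ := hq.2.1.exists_root a _
        ((mul_eq_zero.1 h0).resolve_left (pow_ne_zero _ hs0))
      have hr0 := hq.roots_nonneg (x := a) (fun j => (hτ.trans_le (ha j)).le) r hr
      rw [div_eq_iff hs0] at hw
      have := congrArg Complex.im hw
      simp at this
      nlinarith [mul_nonneg hr0 h.le]
  have huniv : A = Set.univ :=
    (isClopen_iff.1 ⟨hclosed, hopen⟩).resolve_left (Set.nonempty_iff_ne_empty.1 ⟨0, h0⟩)
  have h1 : (1 : ℝ) ∈ A := huniv ▸ Set.mem_univ _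
  simpa [hb] using h1 s hs

theorem isStable (hq : IsPOSHyperbolic n q) : IsStable n q := by
  refine ⟨hq.2.1.1, hq.1, fun z hz h0 => ?_⟩
  obtain ⟨c, hc, hcz⟩ : ∃ c : ℝ, 0 < c ∧ ∀ j, c ≤ (z j).re := by
    rcases isEmpty_or_nonempty (Fin m) with hσ | hσ
    · exact ⟨1, one_pos, fun j => hσ.elim j⟩
    · obtain ⟨j, hj⟩ := Finite.exists_min fun j => (z j).re
      exact ⟨_, hz j, hj⟩
  refine hq.aeval_add_smul_ne_zero (fun j => -(z j).im) (a := fun j => (z j).re - c / 2)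
    -- With `s = i` the point is `i z`; half of `c` is spent on `τ`, and the rest keeps `a ≥ τ`.
    (half_pos hc) (fun j => by linarith [hcz j]) Complex.I (by simp) ?_
  have e : (fun j => ((-(z j).im : ℝ) : ℂ) + Complex.I * ((c / 2 : ℝ) : ℂ) +
      Complex.I * (((z j).re - c / 2 : ℝ) : ℂ)) = fun j => Complex.I * z j := by
    ext j
    apply Complex.ext <;> simp
  rw [e, aeval_smul_of_isHomogeneous hq.2.1.1, h0, mul_zero]

end IsPOSHyperbolic

theorem IsStable.isPOSHyperbolic {m n : ℕ} {p : MvPolynomial (Fin m) ℝ} (hp : IsStable n p) :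
    IsPOSHyperbolic n p := by
  have hdeg : ∀ x, (line p (ones m) x).natDegree = n := fun x => by
    rw [line_eq_pencil]
    exact natDegree_pencil hp.homog _ _ (aeval_neg_ones_ne_zero hp.homog hp.pos_one.ne')
  refine ⟨hp.pos_one, ⟨hp.homog, hp.pos_one.ne', fun x => ?_⟩, fun x hx t ht => ?_⟩
  · rw [← hdeg x, ← Polynomial.splits_iff_card_roots]
    refine splits_of_complex_roots_real fun s hs => ?_
    rw [line_eq_pencil, aeval_pencil] at hs
    by_contra him
    rcases lt_or_gt_of_ne him with h | h
    · exact hp.aeval_ne_zero_of_mul (-Complex.I) _ (fun j => by simp [ones, h]) hs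
    · exact hp.aeval_ne_zero_of_mul Complex.I _ (fun j => by simp [ones, h]) hs
  · by_contra! h
    have hr := (Polynomial.mem_roots'.1 ht).2
    rw [Polynomial.IsRoot, line_eq_pencil, eval_pencil, aeval_real] at hr
    refine hp.eval_ne_zero (fun j => ?_) hr
    have := hx j
    simp only [ones]
    linarith

/-! ### The operation `derivAt` on limits of stable polynomials -/

theorem aeval_derivAt {n : ℕ} {A : Type*} [CommRing A] [Algebra ℝ A] (i : Fin (n + 1))
    (p : MvPolynomial (Fin (n + 1)) ℝ) (z : Fin n → A) :
    MvPolynomial.aeval z (derivAt i p) =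
      MvPolynomial.aeval (i.insertNth (α := fun _ => A) 0 z) (MvPolynomial.pderiv i p) := by
  rw [derivAt, MvPolynomial.comp_aeval_apply]
  congr 2
  ext j
  refine Fin.succAboveCases i ?_ (fun j => ?_) j <;> simp

theorem IsStableLimit.derivAt {k n : ℕ} {p : MvPolynomial (Fin (k + 1)) ℝ}
    (hp : IsStableLimit (n + 1) p) (i : Fin (k + 1)) : IsStableLimit n (derivAt i p) := by
  have hd := hp.pderiv i
  have heval : ∀ x : Fin k → ℝ, MvPolynomial.eval x (VDW.derivAt i p) =
      MvPolynomial.eval (i.insertNth (α := fun _ => ℝ) 0 x) (MvPolynomial.pderiv i p) := fun x => by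
    rw [← aeval_real, aeval_derivAt, aeval_real]
  have hins : ∀ x : Fin k → ℝ, (∀ j, 0 ≤ x j) →
      ∀ j, 0 ≤ i.insertNth (α := fun _ => ℝ) 0 x j := fun x hx j => by
    refine Fin.succAboveCases i ?_ (fun j => ?_) j <;> simp [hx]
  refine ⟨?_, fun x hx => ?_, fun x y hx hxy => ?_, fun z hz => ?_⟩
  · have := hd.homog.aeval (n := 1)
      (g := i.insertNth (α := fun _ => MvPolynomial (Fin k) ℝ) 0 MvPolynomial.X) fun j => by
        refine Fin.succAboveCases i ?_ (fun j => ?_) j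
        · simpa using MvPolynomial.isHomogeneous_zero _ _ _
        · simpa using MvPolynomial.isHomogeneous_X _ _
    rwa [one_mul] at this
  · rw [heval]
    exact hd.nonneg _ (hins x hx)
  · rw [heval, heval]
    refine hd.mono _ _ (hins x hx) fun j => ?_
    refine Fin.succAboveCases i ?_ (fun j => ?_) j <;> simp [hxy]
  · rw [heval, aeval_derivAt]
    refine le_of_eq_of_le ?_ (hd.le_norm (i.insertNth (α := fun _ => ℂ) 0 z) fun j => ?_)
    · congr 2
      ext j
      refine Fin.succAboveCases i ?_ (fun j => ?_) j <;> simp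
    · refine Fin.succAboveCases i ?_ (fun j => ?_) j <;> simp [hz]

/-! ### The univariate inequality -/

theorem g_pos (k : ℕ) : 0 < g k := by
  rcases k with - | - | k
  · simp [g]
  · simp [g]
  · simp only [g, Nat.succ_ne_zero, if_false]
    push_cast
    rw [add_sub_cancel_right]
    positivity

theorem g_le_one (k : ℕ) : g k ≤ 1 := by
  rcases k with - | k
  · simp [g]
  · simp only [g, Nat.succ_ne_zero, if_false]
    push_cast
    rw [add_sub_cancel_right]
    refine pow_le_one₀ (by positivity) ?_
    rw [div_le_one (by positivity)]
    linarith

/-- AM-GM, by multiplying the tangent-line bounds `y ≤ M exp(y/M - 1)`; the exponents cancel when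
`M` is the mean. -/
theorem multiset_prod_le_pow {s : Multiset ℝ} (hs : ∀ y ∈ s, 0 ≤ y) {M : ℝ} (hM : 0 < M)
    (hsum : s.sum = s.card * M) : s.prod ≤ M ^ s.card := by
  have key : s.prod ≤ M ^ s.card * Real.exp (s.sum / M - s.card) := by
    clear hsum
    induction s using Multiset.induction_on with
    | empty => simp
    | cons y s ih =>
      have h1 := ih fun y hy => hs y (Multiset.mem_cons_of_mem hy)
      have hy := hs y (Multiset.mem_cons_self y s)
      have h2 : y ≤ M * Real.exp (y / M - 1) := by
        have := Real.add_one_le_exp (y / M - 1)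
        calc y = M * (y / M) := by field_simp
          _ ≤ _ := mul_le_mul_of_nonneg_left (by linarith) hM.le
      rw [Multiset.prod_cons, Multiset.card_cons, Multiset.sum_cons]
      calc y * s.prod ≤ (M * Real.exp (y / M - 1)) *
            (M ^ s.card * Real.exp (s.sum / M - s.card)) :=
            mul_le_mul h2 h1 (Multiset.prod_nonneg fun y hy => hs y (Multiset.mem_cons_of_mem hy))
              (by positivity)
        _ = M ^ (s.card + 1) * (Real.exp (y / M - 1) * Real.exp (s.sum / M - s.card)) := by ring
        _ = _ := by
          rw [← Real.exp_add]
          congr 2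
          push_cast
          ring
  rwa [hsum, mul_div_cancel_right₀ _ hM.ne', sub_self, Real.exp_zero, mul_one] at key

/-- All roots are negative, so `R(t) = R(0) ∏ (1 + t/(-r))` and `∑ 1/(-r) = R'(0)/R(0)`; AM-GM
applies to the factors. -/
theorem eval_le_pow_of_splits {R : Polynomial ℝ} (hs : R.Splits) (hnn : ∀ k, 0 ≤ R.coeff k)
    (h0 : 0 < R.coeff 0) (hd : R.natDegree ≠ 0) {t : ℝ} (ht : 0 ≤ t) :
    R.eval t ≤
      R.coeff 0 * (1 + t * R.coeff 1 / (R.natDegree * R.coeff 0)) ^ R.natDegree := by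
  have hR0 : R.eval 0 = R.coeff 0 := (Polynomial.coeff_zero_eq_eval_zero R).symm
  have hroots : ∀ r ∈ R.roots, r < 0 := by
    intro r hr
    by_contra! hr0
    have h1 := (Polynomial.mem_roots'.1 hr).2
    rw [Polynomial.IsRoot, Polynomial.eval_eq_sum_range] at h1
    have h2 := Finset.single_le_sum (f := fun k => R.coeff k * r ^ k)
      (s := Finset.range (R.natDegree + 1)) (fun k _ => mul_nonneg (hnn k) (pow_nonneg hr0 k))
      (Finset.mem_range.2 (Nat.succ_pos _))
    rw [h1] at h2
    simp only [pow_zero, mul_one] at h2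
    linarith
  have hc1 : R.coeff 1 = R.coeff 0 * (R.roots.map fun r => 1 / (0 - r)).sum := by
    have := hs.eval_derivative_eq_eval_mul_sum (x := 0) (by rw [hR0]; exact h0.ne')
    rw [← hR0, ← this, ← Polynomial.coeff_zero_eq_eval_zero, Polynomial.coeff_derivative]
    simp
  have heval : R.eval t = R.coeff 0 * (R.roots.map fun r => 1 + t * (1 / (0 - r))).prod := by
    rw [← hR0, hs.eval_eq_prod_roots t, hs.eval_eq_prod_roots 0, mul_assoc,
      ← Multiset.prod_map_mul]
    congr 2
    refine Multiset.map_congr rfl fun r hr => ?_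
    have := (hroots r hr).ne
    have h' : 0 - r ≠ 0 := by simpa using this
    field_simp
    ring
  have hcard := hs.natDegree_eq_card_roots
  have hd' : (R.natDegree : ℝ) ≠ 0 := by exact_mod_cast hd
  have hM : 0 < 1 + t * R.coeff 1 / (R.natDegree * R.coeff 0) := by
    have := hnn 1
    positivity
  rw [heval]
  refine mul_le_mul_of_nonneg_left ?_ h0.le
  have := multiset_prod_le_pow (s := R.roots.map fun r => 1 + t * (1 / (0 - r)))
    (M := 1 + t * R.coeff 1 / (R.natDegree * R.coeff 0)) (fun y hy => ?_) hM ?_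
  · rwa [Multiset.card_map, ← hcard] at this
  · obtain ⟨r, hr, rfl⟩ := Multiset.mem_map.1 hy
    have := hroots r hr
    have : 0 ≤ 1 / (0 - r) := one_div_nonneg.2 (by linarith)
    positivity
  · rw [Multiset.card_map, ← hcard, Multiset.sum_map_add, Multiset.sum_map_mul_left, hc1]
    simp only [Multiset.map_const', Multiset.sum_replicate, nsmul_eq_mul, mul_one, ← hcard]
    field_simp

theorem nonpos_of_forall_mul_le {C b : ℝ} (h : ∀ t : ℝ, 0 < t → C * t ≤ b) : C ≤ 0 := by
  by_contra! hC
  have h1 := h ((|b| + 1) / C) (by positivity)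
  rw [mul_div_cancel₀ _ hC.ne'] at h1
  linarith [le_abs_self b]

/-- A real-rooted polynomial with nonnegative coefficients that dominates `t ↦ C t` on the
positive axis has linear coefficient at least `g(deg) C`. -/
theorem g_mul_le_coeff_one {R : Polynomial ℝ} (hs : R.Splits) (hnn : ∀ k, 0 ≤ R.coeff k) {C : ℝ}
    (hC : 0 ≤ C) (h : ∀ t, 0 < t → C * t ≤ R.eval t) : g R.natDegree * C ≤ R.coeff 1 := by
  rcases (hnn 0).eq_or_lt with h0 | h0
  · have hR : ∀ t, R.eval t = R.divX.eval t * t := fun t => by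
      conv_lhs => rw [← Polynomial.divX_mul_X_add R, ← h0]
      simp
    have h1 := le_of_forall_pos_le (f := fun _ => C) (g := fun t => R.divX.eval t)
      continuous_const R.divX.continuous fun t ht => by
        have := h t ht
        rw [hR] at this
        exact le_of_mul_le_mul_right this ht
    rw [← Polynomial.coeff_zero_eq_eval_zero, Polynomial.coeff_divX] at h1
    exact (mul_le_of_le_one_left hC (g_le_one _)).trans h1
  · by_cases hd : R.natDegree = 0
    · have hC0 : C ≤ 0 := nonpos_of_forall_mul_le (b := R.coeff 0) fun t ht => by
        have := h t ht
        rwa [Polynomial.eq_C_of_natDegree_eq_zero hd, Polynomial.eval_C] at this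
      rw [le_antisymm hC0 hC, mul_zero]
      exact hnn 1
    have hb := fun t (ht : 0 < t) => (h t ht).trans (eval_le_pow_of_splits hs hnn h0 hd ht.le)
    rcases (hnn 1).eq_or_lt with h1 | h1
    · have hC0 : C ≤ 0 := nonpos_of_forall_mul_le (b := R.coeff 0) fun t ht => by
        simpa [← h1] using hb t ht
      rw [le_antisymm hC0 hC, mul_zero]
      exact hnn 1
    · obtain ⟨d, hd⟩ := Nat.exists_eq_succ_of_ne_zero hd
      rw [hd] at hb ⊢
      generalize R.coeff 0 = a at *
      generalize R.coeff 1 = c at *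
      rcases d with - | d
      · have hCc : C - c ≤ 0 := nonpos_of_forall_mul_le (b := a) fun t ht => by
          have := hb t ht
          simp only [Nat.succ_eq_add_one, zero_add, Nat.cast_one, one_mul, pow_one] at this
          rw [mul_add, mul_div_cancel₀ _ h0.ne'] at this
          linarith
        simp [g]
        linarith
      · have hdp : (0 : ℝ) < (d : ℝ) + 1 := by positivity
        -- With `k = d + 2`, this is the minimizer `t = k a / (c (k - 1))` of `(1 + t c/(k a))^k /
        -- t`; the base becomes `k/(k - 1)`.
        have ht : 0 < (d + 1 + 1) * a / (c * (d + 1)) := by positivity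
        have := hb _ ht
        have hM : 1 + ((d : ℝ) + 1 + 1) * a / (c * (d + 1)) * c / (((d + 1).succ : ℕ) * a) =
            ((d : ℝ) + 1 + 1) / (d + 1) := by
          push_cast
          field_simp
        rw [hM] at this
        have hg : g (d + 1).succ = (((d : ℝ) + 1 + 1) / (d + 1))⁻¹ ^ (d + 1) := by
          simp only [g, Nat.succ_ne_zero, if_false]
          push_cast
          rw [inv_div, add_sub_cancel_right]
        rw [hg, inv_pow, inv_mul_le_iff₀ (by positivity)]
        rw [← mul_div_assoc, div_le_iff₀ (by positivity), Nat.succ_eq_add_one, pow_succ] at this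
        have h2 : C * (((d : ℝ) + 1 + 1) * a) ≤
            ((((d : ℝ) + 1 + 1) / (d + 1)) ^ (d + 1) * c) * (((d : ℝ) + 1 + 1) * a) := by
          refine this.trans_eq ?_
          field_simp
        exact le_of_mul_le_mul_right h2 (by positivity)

/-! ### Degree in one variable and rank -/

theorem coeff_pencil_single {σ : Type*} [Fintype σ] [DecidableEq σ] (x : σ → ℝ) (i : σ)
    (p : MvPolynomial σ ℝ) (k : ℕ) :
    (pencil x (Pi.single i 1) p).coeff k = ∑ d ∈ p.support, p.coeff d *
      ((x i ^ (d i - k) * (d i).choose k) * ∏ j ∈ Finset.univ.erase i, x j ^ d j) := by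
  rw [pencil, MvPolynomial.aeval_def, MvPolynomial.eval₂_eq', Polynomial.finsetSum_coeff]
  refine Finset.sum_congr rfl fun d _ => ?_
  rw [← Polynomial.C_eq_algebraMap, Polynomial.coeff_C_mul,
    ← Finset.mul_prod_erase _ _ (Finset.mem_univ i)]
  have : ∏ j ∈ Finset.univ.erase i,
      (Polynomial.C (x j) + Polynomial.X * Polynomial.C ((Pi.single i 1 : σ → ℝ) j)) ^ d j =
      Polynomial.C (∏ j ∈ Finset.univ.erase i, x j ^ d j) := by
    rw [map_prod]
    refine Finset.prod_congr rfl fun j hj => ?_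
    simp [Pi.single_eq_of_ne (Finset.ne_of_mem_erase hj)]
  rw [this, Polynomial.coeff_mul_C, Pi.single_eq_same, Polynomial.C_1, mul_one, add_comm,
    Polynomial.coeff_X_add_C_pow]

theorem coeff_pencil_single_nonneg {σ : Type*} [Fintype σ] [DecidableEq σ]
    {p : MvPolynomial σ ℝ} (hp : ∀ d, 0 ≤ p.coeff d) {x : σ → ℝ} (hx : ∀ j, 0 ≤ x j) (i : σ)
    (k : ℕ) : 0 ≤ (pencil x (Pi.single i 1) p).coeff k := by
  rw [coeff_pencil_single]
  refine Finset.sum_nonneg fun d _ => mul_nonneg (hp d) (mul_nonneg ?_ ?_)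
  · exact mul_nonneg (pow_nonneg (hx i) _) (Nat.cast_nonneg _)
  · exact Finset.prod_nonneg fun j _ => pow_nonneg (hx j) _

/-- Nonnegative coefficients exclude cancellation in the top degree. There `x_i` has exponent 0, so
`x_i = 0` is allowed. -/
theorem natDegree_pencil_single {m : ℕ} {p : MvPolynomial (Fin m) ℝ} (hp : ∀ d, 0 ≤ p.coeff d)
    (i : Fin m) {x : Fin m → ℝ} (hi : 0 ≤ x i) (hx : ∀ j, j ≠ i → 0 < x j) :
    (pencil x (Pi.single i 1) p).natDegree = suppDeg p {i} := by
  have hx0 : ∀ j, 0 ≤ x j := fun j => by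
    rcases eq_or_ne j i with rfl | h
    · exact hi
    · exact (hx j h).le
  rcases eq_or_ne p 0 with rfl | hp0
  · simp [pencil, suppDeg]
  have hS : suppDeg p {i} = p.support.sup fun d => d i := by simp [suppDeg]
  rw [hS]
  refine Polynomial.natDegree_eq_of_le_of_coeff_ne_zero
    (Polynomial.natDegree_le_iff_coeff_eq_zero.2 fun k hk => ?_) ?_
  · rw [coeff_pencil_single]
    refine Finset.sum_eq_zero fun d hd => ?_
    have : d i < k := (Finset.le_sup (f := fun d : Fin m →₀ ℕ => d i) hd).trans_lt hk
    simp [Nat.choose_eq_zero_of_lt this]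
  · obtain ⟨d, hd, hsup⟩ := Finset.exists_mem_eq_sup p.support
      (MvPolynomial.support_nonempty.2 hp0) fun d => d i
    rw [hsup, coeff_pencil_single]
    refine (Finset.sum_pos' (fun e _ => mul_nonneg (hp e) (mul_nonneg ?_ ?_)) ⟨d, hd, ?_⟩).ne'
    · exact mul_nonneg (pow_nonneg hi _) (Nat.cast_nonneg _)
    · exact Finset.prod_nonneg fun j _ => pow_nonneg (hx0 j) _
    · refine mul_pos ((hp d).lt_of_ne' (MvPolynomial.mem_support_iff.1 hd)) (mul_pos ?_ ?_)
      · simp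
      · exact Finset.prod_pos fun j hj => pow_pos (hx j (Finset.ne_of_mem_erase hj)) _

/-- Reversing `q(x - t e)` gives `q(t x - e)`, whose degree is `n` minus the multiplicity of the
root 0; a sign change turns it into `q(e + t x)`. -/
theorem IsHyperbolic.rank_eq_natDegree {m n : ℕ} {q : MvPolynomial (Fin m) ℝ}
    (hq : IsHyperbolic n q (ones m)) (x : Fin m → ℝ) :
    rank q x = (pencil (ones m) x q).natDegree := by
  have h1 : (pencil (fun j => -ones m j) x q).natDegree =
      n - (line q (ones m) x).natTrailingDegree := by
    rw [← reflect_pencil hq.1, ← line_eq_pencil, ← hq.natDegree_line x]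
    exact Polynomial.reverse_natDegree _
  have h2 : pencil (fun j => -ones m j) x q =
      Polynomial.C ((-1) ^ n) * (pencil (ones m) x q).comp (-Polynomial.X) := by
    refine Polynomial.funext fun t => ?_
    rw [Polynomial.eval_mul, Polynomial.eval_C, Polynomial.eval_comp, eval_pencil, eval_pencil,
      ← aeval_smul_of_isHomogeneous hq.1]
    congr 2
    ext j
    simp [add_comm]
  rw [h2, Polynomial.natDegree_C_mul (pow_ne_zero _ (by norm_num)), Polynomial.natDegree_comp,
    Polynomial.natDegree_neg, Polynomial.natDegree_X, mul_one] at h1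
  rw [h1, ← Polynomial.rootMultiplicity_eq_natTrailingDegree', ← Polynomial.count_roots, rank]
  have h3 := Multiset.filter_add_not (fun t : ℝ => t = 0) (line q (ones m) x).roots
  have h4 := congrArg Multiset.card h3
  rw [Multiset.card_add, hq.2.2 x, ← Multiset.countP_eq_card_filter] at h4
  have h5 : Multiset.countP (fun t : ℝ => t = 0) (line q (ones m) x).roots =
      Multiset.count 0 (line q (ones m) x).roots := by
    rw [Multiset.count]
    exact Multiset.countP_congr rfl fun t _ => by simp [eq_comm]
  simp only [ne_eq]
  omega

theorem IsStable.rank_single {m n : ℕ} {q : MvPolynomial (Fin m) ℝ} (hq : IsStable n q)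
    (i : Fin m) : rank q (Pi.single i 1) = suppDeg q {i} := by
  rw [hq.isPOSHyperbolic.2.1.rank_eq_natDegree]
  exact natDegree_pencil_single hq.isStableLimit.coeff_nonneg i zero_le_one fun _ _ => one_pos

/-! ### The capacity inequality -/

theorem cap_zero (m : ℕ) : cap (0 : MvPolynomial (Fin m) ℝ) = 0 := by
  refine le_antisymm (Real.sInf_nonpos ?_) (Real.sInf_nonneg ?_)
  all_goals
    rintro - ⟨x, -, rfl⟩
    simp

theorem IsStable.cap_nonneg {m n : ℕ} {p : MvPolynomial (Fin m) ℝ} (hp : IsStable n p) :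
    0 ≤ cap p := by
  refine Real.sInf_nonneg ?_
  rintro - ⟨x, hx, rfl⟩
  exact (hp.eval_pos hx.1).le

theorem IsStable.cap_le {m n : ℕ} {p : MvPolynomial (Fin m) ℝ} (hp : IsStable n p) {x : Fin m → ℝ}
    (hx : ∀ i, 0 < x i) (hprod : ∏ i, x i = 1) : cap p ≤ MvPolynomial.eval x p := by
  refine csInf_le ⟨0, ?_⟩ ⟨x, ⟨hx, hprod⟩, rfl⟩
  rintro - ⟨y, hy, rfl⟩
  exact (hp.eval_pos hy.1).le

/-- Rescale `x` to product 1; since degree and number of variables agree, `p` and the product scale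
alike. -/
theorem IsStable.cap_mul_prod_le {n : ℕ} {p : MvPolynomial (Fin (n + 1)) ℝ}
    (hp : IsStable (n + 1) p) {x : Fin (n + 1) → ℝ} (hx : ∀ i, 0 < x i) :
    cap p * ∏ i, x i ≤ MvPolynomial.eval x p := by
  have ht : 0 < ∏ i, x i := Finset.prod_pos fun i _ => hx i
  set c : ℝ := (∏ i, x i)⁻¹ ^ (((n + 1 : ℕ) : ℝ)⁻¹) with hc
  have hc0 : 0 < c := Real.rpow_pos_of_pos (inv_pos.2 ht) _
  have hcn : c ^ (n + 1) = (∏ i, x i)⁻¹ :=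
    Real.rpow_inv_natCast_pow (inv_pos.2 ht).le (Nat.succ_ne_zero n)
  have h := hp.cap_le (x := fun j => c * x j) (fun j => mul_pos hc0 (hx j)) (by
    rw [Finset.prod_mul_distrib, Finset.prod_const, Finset.card_univ, Fintype.card_fin, hcn,
      inv_mul_cancel₀ ht.ne'])
  rw [← aeval_real, aeval_smul_of_isHomogeneous hp.homog, hcn, aeval_real] at h
  rw [← le_div_iff₀ ht, div_eq_inv_mul]
  exact h

theorem IsStable.g_mul_cap_le {n : ℕ} {p : MvPolynomial (Fin (n + 1)) ℝ}
    (hp : IsStable (n + 1) p) (i : Fin (n + 1)) :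
    g (suppDeg p {i}) * cap p ≤ cap (derivAt i p) := by
  refine le_csInf ⟨_, ⟨fun _ => 1, ⟨fun _ => one_pos, by simp⟩, rfl⟩⟩ ?_
  rintro - ⟨x, ⟨hx, hprod⟩, rfl⟩
  have hins : ∀ t, 0 < t → ∀ j, 0 < i.insertNth (α := fun _ => ℝ) t x j := fun t ht j => by
    refine Fin.succAboveCases i ?_ (fun j => ?_) j <;> simp [hx, ht]
  set R := pencil (i.insertNth (α := fun _ => ℝ) 0 x) (Pi.single i 1) p with hR
  have heval : ∀ t, R.eval t = MvPolynomial.eval (i.insertNth (α := fun _ => ℝ) t x) p := by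
    intro t
    rw [hR, eval_pencil, aeval_real]
    congr 2
    ext j
    refine Fin.succAboveCases i ?_ (fun j => ?_) j <;> simp
  have hsp : R.Splits := by
    -- The base point with `x_i = 0` is not positive, so real-rootedness is taken at `x_i = 1` and
    -- translated.
    have h := (hp.splits_pencil (hins 1 one_pos) (Pi.single i 1)).comp_X_sub_C 1
    convert h using 1
    refine Polynomial.funext fun t => ?_
    rw [heval, Polynomial.eval_comp, eval_pencil, aeval_real]
    congr 2
    ext j
    refine Fin.succAboveCases i ?_ (fun j => ?_) j <;> simp
  have hx0 : ∀ j, 0 ≤ i.insertNth (α := fun _ => ℝ) 0 x j := fun j => by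
    refine Fin.succAboveCases i ?_ (fun j => ?_) j <;> simp [(hx _).le]
  have hcoeff := hp.isStableLimit.coeff_nonneg
  have hdeg : R.natDegree = suppDeg p {i} := by
    refine natDegree_pencil_single hcoeff i (hx0 i) fun j hj => ?_
    obtain ⟨j, rfl⟩ := Fin.exists_succAbove_eq hj
    simpa using hx j
  have hone : R.coeff 1 = MvPolynomial.eval x (derivAt i p) := by
    have h1 := aeval_dirDeriv (A := ℝ) (Pi.single i 1) p (i.insertNth (α := fun _ => ℝ) 0 x)
    rw [dirDeriv_single] at h1
    simp only [Algebra.algebraMap_self, RingHom.id_apply] at h1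
    rw [← aeval_real, aeval_derivAt, h1, ← Polynomial.coeff_zero_eq_eval_zero,
      Polynomial.coeff_derivative]
    simp [hR]
  change _ ≤ MvPolynomial.eval x (derivAt i p)
  rw [← hdeg, ← hone]
  refine g_mul_le_coeff_one hsp (coeff_pencil_single_nonneg hcoeff hx0 i) hp.cap_nonneg
    fun t ht => ?_
  have := hp.cap_mul_prod_le (hins t ht)
  rw [Fin.prod_univ_succAbove _ i] at this
  simp only [Fin.insertNth_apply_same, Fin.insertNth_apply_succAbove, hprod, mul_one] at this
  rw [heval]
  exact this

/-! ### Consequences for POS-hyperbolic polynomials and VDW-families -/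

theorem IsPOSHyperbolic.derivAt_eq_zero_or {n : ℕ} {q : MvPolynomial (Fin (n + 1)) ℝ}
    (hq : IsPOSHyperbolic (n + 1) q) (i : Fin (n + 1)) :
    derivAt i q = 0 ∨ IsPOSHyperbolic n (derivAt i q) :=
  (hq.isStable.isStableLimit.derivAt i).eq_zero_or_isStable.imp_right IsStable.isPOSHyperbolic

theorem IsPOSHyperbolic.cap_derivAt_pos {n : ℕ} {q : MvPolynomial (Fin (n + 1)) ℝ}
    (hq : IsPOSHyperbolic (n + 1) q) (hcap : 0 < cap q) (i : Fin (n + 1)) :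
    0 < cap (derivAt i q) :=
  (mul_pos (g_pos _) hcap).trans_le (hq.isStable.g_mul_cap_le i)

theorem IsPOSHyperbolic.derivAt_ne_zero {n : ℕ} {q : MvPolynomial (Fin (n + 1)) ℝ}
    (hq : IsPOSHyperbolic (n + 1) q) (hcap : 0 < cap q) (i : Fin (n + 1)) :
    derivAt i q ≠ 0 := by
  intro h
  have := hq.cap_derivAt_pos hcap i
  rw [h, cap_zero] at this
  exact this.false

theorem IsPOSHyperbolic.mem_homPlus {m n : ℕ} {q : MvPolynomial (Fin m) ℝ}
    (hq : IsPOSHyperbolic n q) : q ∈ HomPlus m n :=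
  ⟨hq.2.1.1, hq.isStable.isStableLimit.coeff_nonneg⟩

theorem isVDWFamily_PHP_union_zero : IsVDWFamily fun n => PHP n ∪ {0} where
  subset_homPlus n _ := by
    rintro p (hp | rfl)
    · exact IsPOSHyperbolic.mem_homPlus hp
    · exact ⟨MvPolynomial.isHomogeneous_zero _ _ _, by simp⟩
  derivAt_mem n _ := by
    rintro p (hp | rfl) i
    · exact (IsPOSHyperbolic.derivAt_eq_zero_or hp i).symm
    · exact Or.inr (by simp [derivAt])
  cap_le n := by
    rintro p (hp | rfl) i
    · exact (IsPOSHyperbolic.isStable hp).g_mul_cap_le i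
    · simp [derivAt, cap_zero]

theorem isVDWFamily_PHPPlus : IsVDWFamily PHPPlus where
  subset_homPlus _ _ _ hp := IsPOSHyperbolic.mem_homPlus hp.1
  derivAt_mem _ _ _ hp i :=
    ⟨(IsPOSHyperbolic.derivAt_eq_zero_or hp.1 i).resolve_left
      (IsPOSHyperbolic.derivAt_ne_zero hp.1 hp.2 i), IsPOSHyperbolic.cap_derivAt_pos hp.1 hp.2 i⟩
  cap_le _ _ hp i := (IsPOSHyperbolic.isStable hp.1).g_mul_cap_le i

end VDW

theorem theorem2p5 :
    (∀ (n : ℕ) (q : MvPolynomial (Fin (n + 1)) ℝ), VDW.IsPOSHyperbolic (n + 1) q →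
      (∀ k : ℕ, VDW.rank q (Pi.single 0 1) = k → 1 ≤ k →
        VDW.cap (VDW.derivAt 0 q) ≥ (((k : ℝ) - 1) / k) ^ (k - 1) * VDW.cap q) ∧
      (VDW.derivAt 0 q = 0 ∨ VDW.IsPOSHyperbolic n (VDW.derivAt 0 q)) ∧
      (0 < VDW.cap q → VDW.derivAt 0 q ≠ 0 ∧ VDW.IsPOSHyperbolic n (VDW.derivAt 0 q))) ∧
    VDW.IsVDWFamily (fun n => VDW.PHP n ∪ {0}) ∧
    VDW.IsVDWFamily VDW.PHPPlus := by
  refine ⟨fun n q hq => ⟨fun k hk hk1 => ?_, hq.derivAt_eq_zero_or 0, fun hcap => ?_⟩,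
    VDW.isVDWFamily_PHP_union_zero, VDW.isVDWFamily_PHPPlus⟩
  · have h := hq.isStable.g_mul_cap_le 0
    rw [← hq.isStable.rank_single, hk, VDW.g, if_neg (by omega)] at h
    exact h
  · have hne := hq.derivAt_ne_zero hcap 0
    exact ⟨hne, (hq.derivAt_eq_zero_or 0).resolve_left hne⟩
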